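/- Let $n\ge 1$ and $k\ge 1$ be integers, let $[n]=\{1,\dots,n\}$, and let $c>0$ be a real number. A \emph{weighted hypergraph} on $[n]$ is a function $w$ from the set of all subsets of $[n]$ to the nonnegative real numbers such that $w(\emptyset)=0$ and $\sum_{X\subseteq[n]}w(X)=1$; for $S\subseteq[n]$ put $w^*(S)=\sum_{X\subseteq S}w(X)$. Let $w_1,\dots,w_k$ be weighted hypergraphs on $[n]$ such that $w_i^*([n]\setminus\{j\})\ge 1-c$ for all $i\in\{1,\dots,k\}$ and all $j\in[n]$. Then there is a partition of $[n]$ into two disjoint (possibly empty) sets $S$ and $T$, $[n]=S\cup T$, such that $|w_i^*(S)-w_i^*(T)|\le 2kc$ for all $i\in\{1,\dots,k\}$. -/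

import Mathlib

/-- A weighted hypergraph on the vertex set `[n]` (modelled by `Fin n`): a nonnegative weight on
every subset of `[n]`, zero on the empty set, of total weight one. -/
structure WeightedHypergraph (n : ℕ) where
  /-- The weight of a subset of the vertex set. -/
  w : Finset (Fin n) → ℝ
  nonneg : ∀ X, 0 ≤ w X
  w_empty : w ∅ = 0
  sum_w : ∑ X : Finset (Fin n), w X = 1

/-- The total weight `w^*(S)` of all the subsets of `S`. -/
noncomputable def WeightedHypergraph.star {n : ℕ} (H : WeightedHypergraph n)
    (S : Finset (Fin n)) : ℝ :=
  ∑ X ∈ S.powerset, H.w X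

/-! Encode a partition by a sign vector, with 0 for undecided vertices. The sets through one vertex
weigh at most `c`, so filling in at most `k` zeros changes each imbalance by at most `k * c`. If
every partition failed, each vector with at most `k` zeros would have an index `i` whose imbalance
exceeds `k * c` in absolute value; label the vector by `i` and the sign. This labelling is antipodal
with `k` pairs of labels, so `exists_opposite_labels` gives comparable vectors with opposite labels,
whose imbalances differ by more than `2 * k * c`: a contradiction.

The Tucker lemma comes from Fan's parity count. Without comparable opposite labels, the coboundary
of the indicator of alternating simplices of one sign is the sum of the indicators for both signs
(`coboundary_altIndicator`), while the boundary of the `(d + 1)`-hemisphere is the `d`-hemisphere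
plus its antipode (`hemisphere_coboundary`). Hence the `d`-hemisphere has an odd number of
alternating simplices for every `d ≤ k`. At `d = k` such a simplex needs `k + 1` distinct absolute
values, but only `k` exist. -/

/-! ### Alternating labels and their mod 2 coboundary. -/

section FanLemma

/-- The mod `2` coboundary of a cochain on tuples of vertices. -/
def coboundary {V : Type*} : (List V → ZMod 2) → List V → ZMod 2
  | _, [] => 0
  | φ, v :: l => φ l + coboundary (fun t => φ (v :: t)) l

theorem coboundary_add {V : Type*} (φ ψ : List V → ZMod 2) (l : List V) :
    coboundary (fun t => φ t + ψ t) l = coboundary φ l + coboundary ψ l := by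
  induction l generalizing φ ψ with
  | nil => simp [coboundary]
  | cons v l ih => simp only [coboundary, ih]; ring

theorem coboundary_map {V V' : Type*} (g : V → V') (φ : List V' → ZMod 2) (l : List V) :
    coboundary φ (l.map g) = coboundary (fun t => φ (t.map g)) l := by
  induction l generalizing φ with
  | nil => simp [coboundary]
  | cons v l ih => simp only [coboundary, List.map_cons, ih]

theorem coboundary_congr {V : Type*} {φ ψ : List V → ZMod 2} {l : List V}
    (h : ∀ t, t.Sublist l → φ t = ψ t) : coboundary φ l = coboundary ψ l := by
  induction l generalizing φ ψ with
  | nil => rfl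
  | cons v l ih =>
    simp only [coboundary]
    rw [h l (List.sublist_cons_self v l), ih fun t ht => h _ (ht.cons_cons v)]

theorem coboundary_eq_zero {V : Type*} {φ : List V → ZMod 2} {l : List V}
    (h : ∀ t, φ t = 0) : coboundary φ l = 0 := by
  induction l generalizing φ with
  | nil => rfl
  | cons v l ih => simp only [coboundary]; rw [h l, ih fun t => h _, add_zero]

theorem coboundary_perm {V : Type*} {φ : List V → ZMod 2}
    (h : ∀ l l', l.Perm l' → φ l = φ l') {l l' : List V} (hl : l.Perm l') :
    coboundary φ l = coboundary φ l' := by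
  induction hl generalizing φ with
  | nil => rfl
  | cons x hp ih =>
    simp only [coboundary]
    rw [h _ _ hp, ih fun a b hab => h _ _ (hab.cons x)]
  | swap x y l =>
    simp only [coboundary]
    rw [coboundary_congr (φ := fun t => φ (y :: x :: t)) (ψ := fun t => φ (x :: y :: t))
      fun t _ => h _ _ (List.Perm.swap x y t)]
    ring
  | trans _ _ ih₁ ih₂ => rw [ih₁ h, ih₂ h]

/-- A list of labels is alternating if the absolute values `Nat.div2` increase strictly and the
signs `Nat.bodd` alternate, starting with `s`. -/
def Alternating : Bool → List ℕ → Prop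
  | _, [] => True
  | s, x :: l => x.bodd = s ∧ (∀ y ∈ l, x.div2 < y.div2) ∧ Alternating (!s) l

theorem Alternating.pairwise {s : Bool} {l : List ℕ} (h : Alternating s l) :
    l.Pairwise fun x y => x.div2 < y.div2 := by
  induction l generalizing s with
  | nil => exact List.Pairwise.nil
  | cons x l ih => exact List.Pairwise.cons h.2.1 (ih h.2.2)

theorem le_of_div2_lt_div2 {x y : ℕ} (h : x.div2 < y.div2) : x ≤ y := by
  simp only [Nat.div2_val] at h
  omega

/-- The label opposite to `x`. -/
def oppositeLabel (x : ℕ) : ℕ := Nat.bit (!x.bodd) x.div2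

theorem bodd_oppositeLabel (x : ℕ) : (oppositeLabel x).bodd = !x.bodd := by
  simp [oppositeLabel]

theorem div2_oppositeLabel (x : ℕ) : (oppositeLabel x).div2 = x.div2 := by
  simp [oppositeLabel]

theorem oppositeLabel_oppositeLabel (x : ℕ) : oppositeLabel (oppositeLabel x) = x := by
  conv_lhs => rw [oppositeLabel]
  rw [bodd_oppositeLabel, div2_oppositeLabel, Bool.not_not, Nat.bit_bodd_div2]

theorem Alternating.map_oppositeLabel {s : Bool} {l : List ℕ} (h : Alternating s l) :
    Alternating (!s) (l.map oppositeLabel) := by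
  induction l generalizing s with
  | nil => trivial
  | cons x l ih =>
    refine ⟨by rw [bodd_oppositeLabel, h.1], ?_, ih h.2.2⟩
    intro y hy
    obtain ⟨z, hz, rfl⟩ := List.mem_map.1 hy
    rw [div2_oppositeLabel, div2_oppositeLabel]
    exact h.2.1 z hz

open Classical in
/-- The indicator of the tuples of labels that are alternating after a rearrangement. -/
noncomputable def altIndicator (s : Bool) (l : List ℕ) : ZMod 2 :=
  if ∃ l', l.Perm l' ∧ Alternating s l' then 1 else 0

open Classical in
/-- The indicator of the alternating tuples of labels. -/
noncomputable def sortedAltIndicator (s : Bool) (l : List ℕ) : ZMod 2 :=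
  if Alternating s l then 1 else 0

theorem altIndicator_perm (s : Bool) (l l' : List ℕ) (h : l.Perm l') :
    altIndicator s l = altIndicator s l' := by
  have : (∃ t, l.Perm t ∧ Alternating s t) ↔ ∃ t, l'.Perm t ∧ Alternating s t :=
    ⟨fun ⟨t, h₁, h₂⟩ => ⟨t, h.symm.trans h₁, h₂⟩, fun ⟨t, h₁, h₂⟩ => ⟨t, h.trans h₁, h₂⟩⟩
  classical exact if_congr this rfl rfl

theorem altIndicator_of_sorted (s : Bool) {l : List ℕ} (h : l.Pairwise (· ≤ ·)) :
    altIndicator s l = sortedAltIndicator s l := by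
  have : (∃ t, l.Perm t ∧ Alternating s t) ↔ Alternating s l := by
    refine ⟨fun ⟨t, h₁, h₂⟩ => ?_, fun h => ⟨l, List.Perm.refl l, h⟩⟩
    have ht : t.Pairwise (· ≤ ·) := h₂.pairwise.imp le_of_div2_lt_div2
    rwa [h₁.eq_of_pairwise (fun _ _ _ _ hab hba => le_antisymm hab hba) h ht]
  classical exact if_congr this rfl rfl

theorem altIndicator_map_oppositeLabel (s : Bool) (l : List ℕ) :
    altIndicator s (l.map oppositeLabel) = altIndicator (!s) l := by
  have key : ∀ (s : Bool) (l : List ℕ), (∃ t, l.Perm t ∧ Alternating s t) →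
      ∃ t, (l.map oppositeLabel).Perm t ∧ Alternating (!s) t := fun s l ⟨t, h₁, h₂⟩ =>
    ⟨_, h₁.map _, h₂.map_oppositeLabel⟩
  have hinv : (l.map oppositeLabel).map oppositeLabel = l := by
    simp [Function.comp_def, oppositeLabel_oppositeLabel]
  have : (∃ t, (l.map oppositeLabel).Perm t ∧ Alternating s t) ↔
      ∃ t, l.Perm t ∧ Alternating (!s) t := by
    constructor
    · intro h
      simpa only [hinv] using key _ _ h
    · intro h
      simpa only [Bool.not_not] using key _ _ h
  classical exact if_congr this rfl rfl

/-- Induction on the smallest label: when it is strictly smallest in absolute value, its sign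
decides which faces through it can alternate. -/
theorem coboundary_sortedAltIndicator (s : Bool) {l : List ℕ} (hs : l.Pairwise (· ≤ ·))
    (hc : ∀ x ∈ l, ∀ y ∈ l, x.div2 = y.div2 → x = y) :
    coboundary (sortedAltIndicator s) l = sortedAltIndicator s l + sortedAltIndicator (!s) l := by
  induction l generalizing s with
  | nil =>
    have h : ∀ s, sortedAltIndicator s [] = 1 := fun s => if_pos trivial
    rw [h, h, CharTwo.add_self_eq_zero, coboundary]
  | cons x l ih =>
    have ih' := fun s => ih s hs.of_cons fun a ha b hb =>
      hc a (List.mem_cons_of_mem x ha) b (List.mem_cons_of_mem x hb)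
    by_cases hx : ∀ y ∈ l, x.div2 < y.div2
    · have h₁ : ∀ s, ∀ t, t.Sublist l → sortedAltIndicator s (x :: t) =
          if x.bodd = s then sortedAltIndicator (!s) t else 0 := by
        intro s t ht
        have : ∀ y ∈ t, x.div2 < y.div2 := fun y hy => hx y (ht.subset hy)
        by_cases hb : x.bodd = s
        · rw [if_pos hb]
          classical exact if_congr ⟨fun h => h.2.2, fun h => ⟨hb, this, h⟩⟩ rfl rfl
        · rw [if_neg hb]
          exact if_neg fun h => hb h.1
      rw [coboundary, coboundary_congr (h₁ s), h₁ _ l (List.Sublist.refl l),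
        h₁ _ l (List.Sublist.refl l)]
      by_cases hb : x.bodd = s
      · have hb' : ¬ x.bodd = !s := by rw [hb]; cases s <;> decide
        simp only [hb, if_true]
        rw [if_neg (by cases s <;> decide), ih', Bool.not_not]
        linear_combination CharTwo.add_self_eq_zero (sortedAltIndicator s l)
      · have hb' : x.bodd = !s := by revert hb; cases s <;> cases x.bodd <;> decide
        rw [coboundary_eq_zero (fun t => if_neg hb), if_neg hb, if_pos hb', Bool.not_not]
        ring
    -- The smallest label is repeated: the two faces omitting one copy cancel, and every other face
    -- keeps both copies.
    · cases l with
      | nil => exact absurd (fun y hy => absurd hy List.not_mem_nil) hx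
      | cons y l =>
        have hxy : x = y := by
          by_contra hne
          apply hx
          intro z hz
          have hle : y ≤ z := by
            rcases List.mem_cons.1 hz with rfl | hz
            · exact le_rfl
            · exact List.rel_of_pairwise_cons hs.of_cons hz
          have hle' : x ≤ y := List.rel_of_pairwise_cons hs List.mem_cons_self
          have hd : x.div2 ≠ y.div2 := fun h => hne (hc x (by simp) y (by simp) h)
          simp only [Nat.div2_val] at hd ⊢
          omega
        subst hxy
        have h₀ : ∀ s t, sortedAltIndicator s (x :: x :: t) = 0 := by
          intro s t
          simp [sortedAltIndicator, Alternating]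
        rw [coboundary, coboundary, h₀, h₀, coboundary_eq_zero fun t => h₀ s t]
        linear_combination CharTwo.add_self_eq_zero (sortedAltIndicator s (x :: l))

/-- Vertices of a simplex come ordered by refinement, not by label; everything here is permutation
invariant, so sorting the labels suffices. -/
theorem coboundary_altIndicator (s : Bool) {l : List ℕ}
    (hc : ∀ x ∈ l, ∀ y ∈ l, x.div2 = y.div2 → x = y) :
    coboundary (altIndicator s) l = altIndicator s l + altIndicator (!s) l := by
  have hp : (l.insertionSort (· ≤ ·)).Perm l := List.perm_insertionSort _ l
  have hs : (l.insertionSort (· ≤ ·)).Pairwise (· ≤ ·) := List.pairwise_insertionSort _ l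
  rw [← coboundary_perm (altIndicator_perm s) hp, ← altIndicator_perm s _ _ hp,
    ← altIndicator_perm (!s) _ _ hp, altIndicator_of_sorted _ hs, altIndicator_of_sorted _ hs,
    ← coboundary_sortedAltIndicator s hs fun x hx y hy => hc x (hp.subset hx) y (hp.subset hy)]
  exact coboundary_congr fun t ht => altIndicator_of_sorted s (hs.sublist ht)

theorem altIndicator_eq_zero (s : Bool) {l : List ℕ} {k : ℕ} (hk : ∀ x ∈ l, x.div2 < k)
    (hl : k < l.length) : altIndicator s l = 0 := by
  apply if_neg
  rintro ⟨t, hp, ht⟩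
  have hnd : (t.map Nat.div2).Nodup := by
    rw [List.Nodup, List.pairwise_map]
    exact ht.pairwise.imp fun h => h.ne
  have hsub : (t.map Nat.div2).toFinset ⊆ Finset.range k := by
    intro a ha
    obtain ⟨x, hx, rfl⟩ := List.mem_map.1 (List.mem_toFinset.1 ha)
    exact Finset.mem_range.2 (hk x (hp.symm.subset hx))
  have := Finset.card_le_card hsub
  rw [List.toFinset_card_of_nodup hnd, List.length_map, Finset.card_range, ← hp.length_eq] at this
  omega

theorem altIndicator_singleton (x : ℕ) : altIndicator true [x] + altIndicator false [x] = 1 := by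
  have h : ∀ s, altIndicator s [x] = if x.bodd = s then 1 else 0 := fun s => by
    rw [altIndicator_of_sorted s (List.pairwise_singleton _ x)]
    simp [sortedAltIndicator, Alternating]
  rw [h, h]
  cases x.bodd <;> simp

end FanLemma

/-! ### Hemisphere chains of sign vectors and the Tucker lemma. -/

section Hemisphere

/-- The part of the prism on a tuple that joins its copy with new coordinate `0` to its copy with
new coordinate `s`. -/
def halfPrism {m : ℕ} (s : SignType) :
    (List (Fin (m + 1) → SignType) → ZMod 2) → List (Fin m → SignType) → ZMod 2
  | _, [] => 0
  | φ, v :: l => φ (Fin.cons 0 v :: (v :: l).map (Fin.cons s)) +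
      halfPrism s (fun t => φ (Fin.cons 0 v :: t)) l

theorem halfPrism_add {m : ℕ} (s : SignType) (φ ψ : List (Fin (m + 1) → SignType) → ZMod 2)
    (l : List (Fin m → SignType)) :
    halfPrism s (fun t => φ t + ψ t) l = halfPrism s φ l + halfPrism s ψ l := by
  induction l generalizing φ ψ with
  | nil => simp [halfPrism]
  | cons v l ih => simp only [halfPrism, ih]; ring

/-- The prism operator is a chain homotopy between the two copies. -/
theorem halfPrism_coboundary {m : ℕ} (s : SignType) (φ : List (Fin (m + 1) → SignType) → ZMod 2)
    (l : List (Fin m → SignType)) :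
    halfPrism s (coboundary φ) l + coboundary (halfPrism s φ) l =
      φ (l.map (Fin.cons s)) + φ (l.map (Fin.cons 0)) := by
  induction l generalizing φ with
  | nil => simpa [halfPrism, coboundary] using (CharTwo.add_self_eq_zero (φ [])).symm
  | cons v l ih =>
    have h₁ := ih fun t => φ (Fin.cons 0 v :: t)
    simp only [halfPrism, coboundary, List.map_cons, halfPrism_add, coboundary_add,
      coboundary_map] at h₁ ⊢
    linear_combination h₁ + CharTwo.add_self_eq_zero (φ (Fin.cons 0 v :: l.map (Fin.cons s))) +
      CharTwo.add_self_eq_zero (halfPrism s φ l) + CharTwo.add_self_eq_zero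
        (coboundary (fun t => φ (Fin.cons 0 v :: Fin.cons s v :: t.map (Fin.cons s))) l)

theorem Fin.neg_cons_signType {m : ℕ} (s : SignType) (v : Fin m → SignType) :
    -(Fin.cons s v : Fin (m + 1) → SignType) = Fin.cons (-s) (-v) := by
  funext j
  refine Fin.cases ?_ (fun j => ?_) j <;> simp

theorem halfPrism_neg {m : ℕ} (s : SignType) (φ : List (Fin (m + 1) → SignType) → ZMod 2)
    (l : List (Fin m → SignType)) :
    halfPrism s (fun t => φ (t.map Neg.neg)) l = halfPrism (-s) φ (l.map Neg.neg) := by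
  induction l generalizing φ with
  | nil => rfl
  | cons v l ih =>
    simp only [halfPrism, List.map_cons, Fin.neg_cons_signType, List.map_map, Function.comp_def,
      neg_zero]
    rw [ih fun t => φ (Fin.cons 0 (-v) :: t)]

/-- The prism on a tuple, subdivided symmetrically, from new coordinate `1` to `-1`. -/
def prism {m : ℕ} (φ : List (Fin (m + 1) → SignType) → ZMod 2)
    (l : List (Fin m → SignType)) : ZMod 2 :=
  halfPrism 1 φ l + halfPrism (-1) φ l

/-- The cochain evaluated on a chain that represents the `d`-dimensional hemisphere: the
sign vectors with at most `d` sign changes, triangulated through vectors with at most `d` zeros. -/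
def hemisphere : (m : ℕ) → ℕ → (List (Fin m → SignType) → ZMod 2) → ZMod 2
  | 0, 0, φ => φ [Fin.elim0]
  | 0, _ + 1, _ => 0
  | m + 1, 0, φ => hemisphere m 0 fun l => φ (l.map (Fin.cons 1))
  | m + 1, d + 1, φ => hemisphere m (d + 1) (fun l => φ (l.map (Fin.cons ((-1) ^ (d + 1))))) +
      hemisphere m d (prism φ)

theorem hemisphere_add (m d : ℕ) (φ ψ : List (Fin m → SignType) → ZMod 2) :
    hemisphere m d (fun t => φ t + ψ t) = hemisphere m d φ + hemisphere m d ψ := by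
  induction m generalizing d with
  | zero => cases d <;> simp [hemisphere]
  | succ m ih =>
    cases d with
    | zero => simp only [hemisphere]; exact ih _ _ _
    | succ d =>
      have : prism (fun t => φ t + ψ t) = fun l => prism φ l + prism ψ l := by
        funext l; simp only [prism, halfPrism_add]; ring
      simp only [hemisphere, this, ih]; ring

theorem hemisphere_zero_coboundary (m : ℕ) (φ : List (Fin m → SignType) → ZMod 2) :
    hemisphere m 0 (coboundary φ) = φ [] := by
  induction m with
  | zero => simp [hemisphere, coboundary]
  | succ m ih => simp only [hemisphere, coboundary_map]; rw [ih]; rfl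

theorem prism_coboundary {m : ℕ} (φ : List (Fin (m + 1) → SignType) → ZMod 2) :
    prism (coboundary φ) = fun l => (φ (l.map (Fin.cons 1)) + φ (l.map (Fin.cons (-1)))) +
      coboundary (prism φ) l := by
  funext l
  have h : coboundary (prism φ) l = _ := coboundary_add (halfPrism 1 φ) (halfPrism (-1) φ) l
  have h₁ := halfPrism_coboundary 1 φ l
  have h₂ := halfPrism_coboundary (-1) φ l
  simp only [prism] at h ⊢
  rw [h]
  linear_combination h₁ + h₂ + CharTwo.add_self_eq_zero (φ (l.map (Fin.cons 0))) -
    CharTwo.add_self_eq_zero (coboundary (halfPrism 1 φ) l) -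
    CharTwo.add_self_eq_zero (coboundary (halfPrism (-1) φ) l)

theorem prism_neg {m : ℕ} (φ : List (Fin (m + 1) → SignType) → ZMod 2) :
    prism (fun t => φ (t.map Neg.neg)) = fun l => prism φ (l.map Neg.neg) := by
  funext l
  simp only [prism, halfPrism_neg, neg_neg]
  ring

/-- The prism over the `d`-hemisphere has ends with new coordinate `1` and `-1`. One end cancels
against the boundary of the constant-coordinate piece; the alternating sign `(-1) ^ (d + 1)` makes
the remaining end fit the `d`-hemisphere one coordinate up. -/
theorem hemisphere_coboundary (m d : ℕ) (φ : List (Fin m → SignType) → ZMod 2) :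
    hemisphere m (d + 1) (coboundary φ) =
      hemisphere m d φ + hemisphere m d (fun l => φ (l.map Neg.neg)) := by
  induction m generalizing d with
  | zero =>
    cases d with
    | zero =>
      have : (-Fin.elim0 : Fin 0 → SignType) = Fin.elim0 := Subsingleton.elim _ _
      simpa [hemisphere, this] using (CharTwo.add_self_eq_zero (φ [Fin.elim0])).symm
    | succ d => simp [hemisphere]
  | succ m ih =>
    have hsign : ∀ s : SignType, (fun l : List (Fin m → SignType) =>
        φ ((l.map (Fin.cons s)).map Neg.neg)) =
        fun l => φ ((l.map Neg.neg).map (Fin.cons (-s))) := by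
      intro s
      funext l
      simp only [List.map_map, Function.comp_def, Fin.neg_cons_signType]
    cases d with
    | zero =>
      simp only [hemisphere, prism_coboundary, hemisphere_add, coboundary_map, ih, hsign,
        hemisphere_zero_coboundary]
      simp only [zero_add, pow_one, prism, halfPrism, add_zero]
      linear_combination
        CharTwo.add_self_eq_zero (hemisphere m 0 fun l => φ (l.map (Fin.cons (-1))))
    | succ d =>
      simp only [hemisphere, prism_coboundary, hemisphere_add, coboundary_map, ih, hsign,
        prism_neg]
      rcases neg_one_pow_eq_or SignType d with h | h
      · simp only [pow_succ, h, mul_neg, mul_one, neg_neg]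
        linear_combination
          CharTwo.add_self_eq_zero (hemisphere m (d + 1) fun l => φ (l.map (Fin.cons 1)))
      · simp only [pow_succ, h, mul_neg, mul_one, neg_neg]
        linear_combination
          CharTwo.add_self_eq_zero (hemisphere m (d + 1) fun l => φ (l.map (Fin.cons (-1))))

/-- The number of vanishing entries of a sign vector. -/
def zeroCount {m : ℕ} (v : Fin m → SignType) : ℕ := (Finset.univ.filter fun j => v j = 0).card

/-- `w` arises from `v` by giving signs to some of its vanishing entries. -/
def Refines {m : ℕ} (v w : Fin m → SignType) : Prop := ∀ j, v j = 0 ∨ v j = w j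

theorem zeroCount_cons {m : ℕ} (s : SignType) (v : Fin m → SignType) :
    zeroCount (Fin.cons s v : Fin (m + 1) → SignType) = zeroCount v + if s = 0 then 1 else 0 := by
  simp only [zeroCount, Finset.card_filter, Fin.sum_univ_succ, Fin.cons_zero, Fin.cons_succ]
  ring

theorem Refines.cons {m : ℕ} {s t : SignType} (h : s = 0 ∨ s = t) {v w : Fin m → SignType}
    (hvw : Refines v w) : Refines (Fin.cons s v : Fin (m + 1) → SignType) (Fin.cons t w) := by
  intro j
  refine Fin.cases ?_ (fun j => ?_) j
  · simpa using h
  · simpa using hvw j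

/-- The simplices of dimension `d` of the triangulation whose vertices have at most `d` zeros. -/
def IsFlag {m : ℕ} (d : ℕ) (l : List (Fin m → SignType)) : Prop :=
  l.Pairwise Refines ∧ ∀ v ∈ l, zeroCount v ≤ d

theorem IsFlag.map_cons {m d : ℕ} {l : List (Fin m → SignType)} (h : IsFlag d l) {s : SignType}
    (hs : s ≠ 0) : IsFlag d (l.map (Fin.cons s : _ → Fin (m + 1) → SignType)) := by
  refine ⟨List.pairwise_map.2 (h.1.imp fun hvw => hvw.cons (Or.inr rfl)), ?_⟩
  intro w hw
  obtain ⟨v, hv, rfl⟩ := List.mem_map.1 hw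
  rw [zeroCount_cons, if_neg hs]
  exact h.2 v hv

theorem halfPrism_eq_zero {m d : ℕ} {s : SignType} (hs : s ≠ 0)
    {φ : List (Fin (m + 1) → SignType) → ZMod 2} {l : List (Fin m → SignType)} (hl : IsFlag d l)
    -- The clause on the entries of `t` serves the induction: it lets `Fin.cons 0 v` be prepended to
    -- `t` with refinement preserved.
    (hφ : ∀ t, t.length = l.length + 1 → IsFlag (d + 1) t →
      (∀ u ∈ t, ∃ v ∈ l, ∃ a, u = Fin.cons a v) → φ t = 0) :
    halfPrism s φ l = 0 := by
  induction l generalizing φ with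
  | nil => rfl
  | cons v l ih =>
    have hv : ∀ w ∈ l, Refines v w := (List.pairwise_cons.1 hl.1).1
    have hl' : IsFlag d l := ⟨hl.1.of_cons, fun w hw => hl.2 w (List.mem_cons_of_mem v hw)⟩
    have hzero : zeroCount (Fin.cons 0 v : Fin (m + 1) → SignType) ≤ d + 1 := by
      rw [zeroCount_cons, if_pos rfl]
      exact Nat.succ_le_succ (hl.2 v List.mem_cons_self)
    have hrefl : Refines v v := fun j => Or.inr rfl
    rw [halfPrism, ih hl', add_zero]
    · have hm := hl.map_cons hs
      refine hφ _ (by simp) ⟨List.pairwise_cons.2 ⟨?_, hm.1⟩, ?_⟩ ?_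
      · intro u hu
        obtain ⟨w, hw, rfl⟩ := List.mem_map.1 hu
        refine Refines.cons (Or.inl rfl) ?_
        rcases List.mem_cons.1 hw with rfl | hw
        · exact hrefl
        · exact hv w hw
      · intro u hu
        rcases List.mem_cons.1 hu with rfl | hu
        · exact hzero
        · exact (hm.2 u hu).trans (Nat.le_succ d)
      · intro u hu
        rcases List.mem_cons.1 hu with rfl | hu
        · exact ⟨v, List.mem_cons_self, 0, rfl⟩
        · obtain ⟨w, hw, rfl⟩ := List.mem_map.1 hu
          exact ⟨w, hw, s, rfl⟩
    · intro t ht hft hmem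
      refine hφ _ (by simp [ht]) ⟨List.pairwise_cons.2 ⟨?_, hft.1⟩, ?_⟩ ?_
      · intro u hu
        obtain ⟨w, hw, a, rfl⟩ := hmem u hu
        exact Refines.cons (Or.inl rfl) (hv w hw)
      · intro u hu
        rcases List.mem_cons.1 hu with rfl | hu
        · exact hzero
        · exact hft.2 u hu
      · intro u hu
        rcases List.mem_cons.1 hu with rfl | hu
        · exact ⟨v, List.mem_cons_self, 0, rfl⟩
        · obtain ⟨w, hw, a, rfl⟩ := hmem u hu
          exact ⟨w, List.mem_cons_of_mem v hw, a, rfl⟩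

theorem hemisphere_eq_zero {m d : ℕ} {φ : List (Fin m → SignType) → ZMod 2}
    (hφ : ∀ l, l.length = d + 1 → IsFlag d l → φ l = 0) : hemisphere m d φ = 0 := by
  induction m generalizing d with
  | zero =>
    cases d with
    | zero =>
      refine hφ _ rfl ⟨List.pairwise_singleton _ _, fun v _ => ?_⟩
      simp [zeroCount]
    | succ d => rfl
  | succ m ih =>
    cases d with
    | zero =>
      exact ih fun l hl hf => hφ _ (by simpa using hl) (hf.map_cons (by decide))
    | succ d =>
      rw [hemisphere, ih, ih, add_zero]
      · intro l hl hf
        rw [prism, halfPrism_eq_zero (by decide) hf, halfPrism_eq_zero (by decide) hf, add_zero]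
        all_goals exact fun t ht hft _ => hφ t (by omega) hft
      · intro l hl hf
        refine hφ _ (by simpa using hl) (hf.map_cons ?_)
        rcases neg_one_pow_eq_or SignType (d + 1) with h | h <;> rw [h] <;> decide

theorem hemisphere_congr {m d : ℕ} {φ ψ : List (Fin m → SignType) → ZMod 2}
    (h : ∀ l, l.length = d + 1 → IsFlag d l → φ l = ψ l) :
    hemisphere m d φ = hemisphere m d ψ := by
  have h₀ : hemisphere m d (fun l => φ l + ψ l) = 0 :=
    hemisphere_eq_zero fun l hl hf => by rw [h l hl hf, CharTwo.add_self_eq_zero]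
  rw [hemisphere_add] at h₀
  exact CharTwo.add_eq_zero.1 h₀

theorem hemisphere_zero (m : ℕ) (φ : List (Fin m → SignType) → ZMod 2) :
    ∃ v, zeroCount v = 0 ∧ hemisphere m 0 φ = φ [v] := by
  induction m with
  | zero => exact ⟨Fin.elim0, by simp [zeroCount], rfl⟩
  | succ m ih =>
    obtain ⟨v, hv, h⟩ := ih fun l => φ (l.map (Fin.cons 1))
    refine ⟨Fin.cons 1 v, ?_, h⟩
    rw [zeroCount_cons, hv, if_neg (by decide)]

/-- A Tucker type lemma: an antipodal labelling by `k` pairs of opposite labels of the sign vectors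
with at most `k` zeros has a pair of comparable vectors with opposite labels. -/
theorem exists_opposite_labels {m k : ℕ} (L : (Fin m → SignType) → ℕ)
    (hL : ∀ v, zeroCount v ≤ k → (L v).div2 < k)
    (hneg : ∀ v, zeroCount v ≤ k → L (-v) = oppositeLabel (L v)) :
    ∃ v w, zeroCount v ≤ k ∧ zeroCount w ≤ k ∧ Refines v w ∧ (L v).div2 = (L w).div2 ∧
      L v ≠ L w := by
  by_contra hcon
  push Not at hcon
  -- Fan's count: alternating simplices of either starting sign are odd in number.
  have hodd : ∀ d ≤ k, hemisphere m d (fun l => altIndicator true (l.map L)) +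
      hemisphere m d (fun l => altIndicator false (l.map L)) = 1 := by
    intro d
    induction d with
    | zero =>
      intro _
      rw [← hemisphere_add]
      obtain ⟨v, _, h⟩ := hemisphere_zero m fun l =>
        altIndicator true (l.map L) + altIndicator false (l.map L)
      rw [h]
      exact altIndicator_singleton (L v)
    | succ d ih =>
      intro hd
      rw [← ih (by omega), ← hemisphere_add]
      have h₁ : hemisphere m (d + 1) (fun l =>
          altIndicator true (l.map L) + altIndicator false (l.map L)) =
          hemisphere m (d + 1) (coboundary fun l => altIndicator true (l.map L)) := by
        refine hemisphere_congr fun l _ hf => ?_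
        rw [← coboundary_map, coboundary_altIndicator]
        · rfl
        have hpw : l.Pairwise fun v w => (L v).div2 = (L w).div2 → L v = L w :=
          hf.1.imp_of_mem fun hv hw hvw =>
            hcon _ _ ((hf.2 _ hv).trans hd) ((hf.2 _ hw).trans hd) hvw
        have hsymm : Std.Symm fun v w => (L v).div2 = (L w).div2 → L v = L w :=
          ⟨fun v w h h' => (h h'.symm).symm⟩
        intro x hx y hy
        obtain ⟨v, hv, rfl⟩ := List.mem_map.1 hx
        obtain ⟨w, hw, rfl⟩ := List.mem_map.1 hy
        exact List.Pairwise.forall_of_forall (fun v _ _ => rfl) hpw hv hw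
      rw [h₁, hemisphere_coboundary]
      congr 1
      -- On the antipodal half, negating the vertices exchanges the two starting signs.
      refine hemisphere_congr fun l _ hf => ?_
      have : (l.map Neg.neg).map L = (l.map L).map oppositeLabel := by
        simp only [List.map_map]
        refine List.map_congr_left fun v hv => hneg v ((hf.2 v hv).trans (by omega))
      rw [this, altIndicator_map_oppositeLabel]
      rfl
  have hzero : ∀ s, hemisphere m k (fun l => altIndicator s (l.map L)) = 0 := by
    refine fun s => hemisphere_eq_zero fun l hl hf => ?_
    refine altIndicator_eq_zero s (k := k) ?_ (by simp [hl])
    intro x hx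
    obtain ⟨v, hv, rfl⟩ := List.mem_map.1 hx
    exact hL v (hf.2 v hv)
  have := hodd k le_rfl
  rw [hzero, hzero] at this
  exact absurd this (by decide)

end Hemisphere

/-! ### Imbalance of a sign vector. -/

namespace WeightedHypergraph

variable {n : ℕ} (H : WeightedHypergraph n)

theorem star_mono {S T : Finset (Fin n)} (h : S ⊆ T) : H.star S ≤ H.star T :=
  Finset.sum_le_sum_of_subset_of_nonneg (Finset.powerset_mono.2 h) fun X _ _ => H.nonneg X

/-- Any set gained contains `j`, and the sets containing `j` weigh at most `c` together. -/
theorem star_insert_le {c : ℝ} (hc : ∀ j, 1 - c ≤ H.star (Finset.univ \ {j}))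
    (S : Finset (Fin n)) (j : Fin n) : H.star (insert j S) ≤ H.star S + c := by
  have h₁ : (insert j S).powerset ⊆ S.powerset ∪ (Finset.univ \ (Finset.univ \ {j}).powerset) := by
    intro X hX
    simp only [Finset.mem_union, Finset.mem_sdiff, Finset.mem_univ, true_and,
      Finset.mem_powerset] at hX ⊢
    by_cases hj : j ∈ X
    · refine Or.inr fun h => ?_
      simpa using h hj
    · exact Or.inl ((Finset.subset_insert_iff_of_notMem hj).1 hX)
  have h₂ : H.star (insert j S) ≤
      ∑ X ∈ S.powerset ∪ (Finset.univ \ (Finset.univ \ {j}).powerset), H.w X :=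
    Finset.sum_le_sum_of_subset_of_nonneg h₁ fun X _ _ => H.nonneg X
  have h₃ : ∑ X ∈ S.powerset ∪ (Finset.univ \ (Finset.univ \ {j}).powerset), H.w X ≤
      H.star S + ∑ X ∈ Finset.univ \ (Finset.univ \ {j}).powerset, H.w X := by
    have := Finset.sum_union_inter (s₁ := S.powerset)
      (s₂ := Finset.univ \ (Finset.univ \ {j}).powerset) (f := H.w)
    have h' : 0 ≤ ∑ X ∈ S.powerset ∩ (Finset.univ \ (Finset.univ \ {j}).powerset), H.w X :=
      Finset.sum_nonneg fun X _ => H.nonneg X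
    simp only [star]
    linarith
  have h₄ : ∑ X ∈ Finset.univ \ (Finset.univ \ {j}).powerset, H.w X +
      H.star (Finset.univ \ {j}) = 1 := by
    rw [star, Finset.sum_sdiff (Finset.subset_univ _), H.sum_w]
  linarith [hc j]

theorem star_union_le {c : ℝ} (hc : ∀ j, 1 - c ≤ H.star (Finset.univ \ {j}))
    (S A : Finset (Fin n)) : H.star (S ∪ A) ≤ H.star S + A.card * c := by
  induction A using Finset.induction_on with
  | empty => simp
  | insert j A hj ih =>
    rw [Finset.union_insert, Finset.card_insert_of_notMem hj]
    have := H.star_insert_le hc (S ∪ A) j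
    push_cast
    linarith

/-- The weight on the positive entries minus the weight on the negative entries. -/
noncomputable def imbalance (v : Fin n → SignType) : ℝ :=
  H.star (Finset.univ.filter fun j => v j = 1) - H.star (Finset.univ.filter fun j => v j = -1)

theorem imbalance_neg (v : Fin n → SignType) : H.imbalance (-v) = -H.imbalance v := by
  have h₁ : ∀ s : SignType, -s = 1 ↔ s = -1 := by decide
  have h₂ : ∀ s : SignType, -s = -1 ↔ s = 1 := by decide
  simp only [imbalance, Pi.neg_apply, h₁, h₂]
  ring

/-- Both sides can only grow, each by at most `zeroCount v * c`, so the difference of the growths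
obeys the same bound without a factor 2. -/
theorem abs_imbalance_sub_le {c : ℝ}
    (hc : ∀ j, 1 - c ≤ H.star (Finset.univ \ {j})) {v w : Fin n → SignType} (h : Refines v w) :
    |H.imbalance v - H.imbalance w| ≤ zeroCount v * c := by
  have key : ∀ s : SignType, s ≠ 0 →
      H.star (Finset.univ.filter fun j => v j = s) ≤ H.star (Finset.univ.filter fun j => w j = s) ∧
      H.star (Finset.univ.filter fun j => w j = s) ≤
        H.star (Finset.univ.filter fun j => v j = s) + zeroCount v * c := by
    intro s hs
    constructor
    · apply H.star_mono
      intro j hj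
      simp only [Finset.mem_filter, Finset.mem_univ, true_and] at hj ⊢
      rcases h j with h' | h'
      · exact absurd (hj.symm.trans h') hs
      · exact h'.symm.trans hj
    · refine (H.star_mono ?_).trans (H.star_union_le hc _ (Finset.univ.filter fun j => v j = 0))
      intro j hj
      simp only [Finset.mem_union, Finset.mem_filter, Finset.mem_univ, true_and] at hj ⊢
      rcases h j with h' | h'
      · exact Or.inr h'
      · exact Or.inl (h'.trans hj)
  have h₁ := key 1 (by decide)
  have h₂ := key (-1) (by decide)
  rw [abs_le]
  simp only [imbalance]
  constructor <;> linarith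

end WeightedHypergraph

/-! ### The labelling by an unbalanced hypergraph. -/

theorem mainTheorem3 (k : ℕ) (hk : 1 ≤ k) (c : ℝ) (hc : 0 < c) (n : ℕ) (hn : 1 ≤ n)
    (W : Fin k → WeightedHypergraph n)
    (hW : ∀ (i : Fin k) (j : Fin n), 1 - c ≤ (W i).star (Finset.univ \ {j})) :
    ∃ S T : Finset (Fin n), S ∪ T = Finset.univ ∧ Disjoint S T ∧
      ∀ i : Fin k, |(W i).star S - (W i).star T| ≤ 2 * (k : ℝ) * c := by
  by_contra hcon
  push Not at hcon
  have hclose : ∀ i {v w : Fin n → SignType}, zeroCount v ≤ k → Refines v w →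
      |(W i).imbalance v - (W i).imbalance w| ≤ k * c := fun i v w hv h =>
    ((W i).abs_imbalance_sub_le (hW i) h).trans
      (mul_le_mul_of_nonneg_right (Nat.cast_le.2 hv) hc.le)
  have hlarge : ∀ v : Fin n → SignType, zeroCount v ≤ k → ∃ i, k * c < |(W i).imbalance v| := by
    intro v hv
    -- Any completion of `v` gives a partition, which is off by more than `2 * k * c`; undoing it
    -- costs at most `k * c`.
    let w : Fin n → SignType := fun j => if v j = 0 then 1 else v j
    have hvw : Refines v w := fun j => by
      by_cases h : v j = 0
      · exact Or.inl h
      · exact Or.inr (by simp [w, h])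
    have hw : ∀ j, w j = 1 ∨ w j = -1 := by
      intro j
      have : ∀ s : SignType, (if s = 0 then 1 else s) = 1 ∨ (if s = 0 then 1 else s) = -1 := by
        decide
      exact this (v j)
    obtain ⟨i, hi⟩ := hcon (Finset.univ.filter fun j => w j = 1)
      (Finset.univ.filter fun j => w j = -1)
      (by ext j; simpa using hw j)
      (Finset.disjoint_filter.2 fun j _ h₁ h₂ => absurd (h₁.symm.trans h₂) (by decide))
    refine ⟨i, ?_⟩
    have h₁ : 2 * (k : ℝ) * c < |(W i).imbalance w| := hi
    have h₂ := hclose i hv hvw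
    have h₃ := abs_sub_abs_le_abs_sub ((W i).imbalance w) ((W i).imbalance v)
    rw [abs_sub_comm] at h₃
    linarith
  have : Nonempty (Fin k) := ⟨⟨0, hk⟩⟩
  -- The choice depends only on the predicate, which is unchanged under `v ↦ -v`; hence `idx` is
  -- even.
  let idx : (Fin n → SignType) → Fin k := fun v =>
    Classical.epsilon fun i => k * c < |(W i).imbalance v|
  have hidx : ∀ v, zeroCount v ≤ k → k * c < |(W (idx v)).imbalance v| := fun v hv =>
    Classical.epsilon_spec (hlarge v hv)
  have hidx_neg : ∀ v, idx (-v) = idx v := fun v => by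
    simp only [idx, WeightedHypergraph.imbalance_neg, abs_neg]
  have hkc : 0 ≤ k * c := by positivity
  obtain ⟨v, w, hv, hw, hvw, hdiv, hne⟩ := exists_opposite_labels (k := k)
    (fun v => Nat.bit (decide (0 < (W (idx v)).imbalance v)) (idx v))
    (fun v _ => by simp)
    (fun v hv => by
      have h := hidx v hv
      have hb : decide (0 < -(W (idx v)).imbalance v) = !decide (0 < (W (idx v)).imbalance v) := by
        rcases lt_abs.1 h with h' | h'
        · have h₁ : 0 < (W (idx v)).imbalance v := by linarith
          have h₂ : ¬ 0 < -(W (idx v)).imbalance v := by linarith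
          simp only [h₁, h₂, decide_true, decide_false, Bool.not_true]
        · have h₁ : ¬ 0 < (W (idx v)).imbalance v := by linarith
          have h₂ : 0 < -(W (idx v)).imbalance v := by linarith
          simp only [h₁, h₂, decide_true, decide_false, Bool.not_false]
      simp only [hidx_neg, WeightedHypergraph.imbalance_neg, oppositeLabel, Nat.bodd_bit,
        Nat.div2_bit, hb])
  simp only [Nat.div2_bit] at hdiv
  have hi : idx v = idx w := Fin.ext hdiv
  have hv' := hidx v hv
  have hw' := hidx w hw
  have hd := abs_le.1 (hclose (idx w) hv hvw)
  rw [hi] at hv' hne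
  apply hne
  congr 1
  rw [decide_eq_decide]
  -- Two imbalances beyond `k * c` in absolute value and within `k * c` of each other have the same
  -- sign.
  rcases lt_abs.1 hv' with h₁ | h₁ <;> rcases lt_abs.1 hw' with h₂ | h₂ <;>
    constructor <;> intro h <;> linarith
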